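/- Let $\mathcal S,\mathcal A$ be finite non-empty sets, $P(s,a,s')$ transition probabilities, $r(s,a,s')$ a deterministic reward, $\gamma\in[0,1)$, $N\ge 1$, and let $b_1,\dots,b_N\in\mathbb R$ be fixed shifts. Let $R\ge 1$ be such that $|r(s,a,s')+b_i|\le R$ for all $s,a,s',i$ (under the normalization that all shifted rewards are bounded by $1$, take $R=1$). Let $\alpha\in(0,1)$ be a constant step size, let the initial estimators satisfy $|Q_{i,0}(s,a)|\le 1$ for all $i,s,a$, let $d$ be a probability distribution on $\mathcal S\times\mathcal A$ with $d(s,a)>0$ everywhere, and let $\mu$ be a probability distribution on $\{1,\dots,N\}$ with $\mu(i)>0$ everywhere. Dummy adversarial Q-learning (DAQ) updates $$Q_i(s_t,a_t)\leftarrow Q_i(s_t,a_t)+\alpha\bigl[r(s_t,a_t,s_t')+b_i+\gamma\,V(s_t')-Q_i(s_t,a_t)\bigr],$$ with $V(s')=\max_{a'}\min_jQ_j(s',a')$ (maxmin version) or $V(s')=\min_j\max_{a'}Q_j(s',a')$ (minmax version). In the asynchronous version only $i=i_t$ is updated at step $t$, where $(s_t,a_t,i_t,s'_t)_{t\ge0}$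 are i.i.d. with law $d(s,a)\mu(i)P(s,a,s')$. In the synchronous version all $i$ are updated, where $(s_t,a_t,s_t')_{t\ge0}$ are i.i.d. with law $d(s,a)P(s,a,s')$. Let $Q_i^*(s,a)=Q^*(s,a,i)$, where $Q^*$ is the optimal Q-function of the alternating two-player zero-sum discounted Markov game in which the user chooses $a$ to maximize and a dummy adversary chooses $i\in\{1,\dots,N\}$ to minimize the expected discounted return, the reward is $r(s,a,s')+b_i$, and the transitions are $P(s,a,s')$, independently of $i$. In the maxmin version the user moves first and the adversary observes its action. In the minmax version the order is reversed. Thus $Q^*(s,a,i)$ is the max-min (respectively min-max) over deterministic policies of the expected discounted return after the initial choices $s,a,i$. For the asynchronous version put $d_{\max}=\max_{s,a,i}d(s,a)\mu(i)$ and $d_{\min}=\min_{s,a,i}d(s,a)\mu(i)$; for the synchronous version put $d_{\max}=\max_{s,a}d(s,a)$ and $d_{\min}=\min_{s,a}d(s,a)$. Let $\rho=1-\alpha d_{\min}(1-\gamma)$. Then for both versions of $V$, for the asynchronous as well as the synchronous version, every $i$ and every $t\ge0$, the estimator $Q_{i,t}$ after $t$ steps satisfies $$\mathbb E\|Q_{i,t}-Q_i^*\|_\infty\le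 R\left[\frac{27\,d_{\max}|\mathcal S\times\mathcal A|N\alpha^{1/2}}{d_{\min}^{3/2}(1-\gamma)^{5/2}}+\frac{6|\mathcal S\times\mathcal A|^{3/2}N^{3/2}}{1-\gamma}\rho^t+\frac{24\gamma d_{\max}|\mathcal S\times\mathcal A|^{2/3}N^{2/3}}{1-\gamma}\cdot\frac{3}{d_{\min}(1-\gamma)}\rho^{t/2-1}\right].$$ -/

import Mathlib

open MeasureTheory ProbabilityTheory

noncomputable section

/-- A finite discounted Markov decision process: transition probabilities `P s a s'`, deterministic
rewards `r s a s'`, discount factor `γ ∈ [0, 1)`. -/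
structure MDP (S A : Type*) [Fintype S] where
  P : S → A → S → ℝ
  P_nonneg : ∀ s a s', 0 ≤ P s a s'
  P_sum : ∀ s a, ∑ s', P s a s' = 1
  r : S → A → S → ℝ
  γ : ℝ
  γ_nonneg : 0 ≤ γ
  γ_lt_one : γ < 1

/-- A finite two-player zero-sum discounted Markov game. The user has actions `A` and maximizes
the return, the adversary has actions `B` and minimizes it. -/
structure MarkovGame (S A B : Type*) [Fintype S] where
  P : S → A → B → S → ℝ
  P_nonneg : ∀ s a b s', 0 ≤ P s a b s'
  P_sum : ∀ s a b, ∑ s', P s a b s' = 1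
  r : S → A → B → S → ℝ
  γ : ℝ
  γ_nonneg : 0 ≤ γ
  γ_lt_one : γ < 1

/-- The order of the alternating turns. `maxmin`: the user moves first and the adversary observes
the user's action. `minmax`: the adversary moves first and the user observes its action. -/
inductive TurnOrder
  | maxmin
  | minmax

namespace MarkovGame

variable {S A B : Type*} [Fintype S]

/-- The expected reward `𝔼[r_t | s₀ = s, a₀ = a, b₀ = b]` at time `t`, when from time `1` on the
pair of actions taken in a state `s'` is `g s'`. -/
def expReward (G : MarkovGame S A B) (g : S → A × B) : ℕ → S → A → B → ℝ
  | 0, s, a, b => ∑ s', G.P s a b s' * G.r s a b s'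
  | t + 1, s, a, b => ∑ s', G.P s a b s' * G.expReward g t s' (g s').1 (g s').2

/-- The expected discounted return `∑ₜ γᵗ 𝔼[r_t | s₀ = s, a₀ = a, b₀ = b]`, when from time `1` on
the pair of actions taken in a state `s'` is `g s'`. -/
def policyQ (G : MarkovGame S A B) (g : S → A × B) (s : S) (a : A) (b : B) : ℝ :=
  ∑' t : ℕ, G.γ ^ t * G.expReward g t s a b

/-- The optimal Q-function of the alternating game: the value of the expected discounted return
after the initial triple `(s, a, b)`, over the deterministic policies of both players. The player
who moves second has a policy that depends on the action of the first. -/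
def optQ (G : MarkovGame S A B) : TurnOrder → S → A → B → ℝ
  | .maxmin, s, a, b =>
      ⨆ π : S → A, ⨅ ν : S → A → B, G.policyQ (fun x => (π x, ν x (π x))) s a b
  | .minmax, s, a, b =>
      ⨅ ν : S → B, ⨆ π : S → B → A, G.policyQ (fun x => (π x (ν x), ν x)) s a b

end MarkovGame

namespace MDP

variable {S A : Type*} [Fintype S] {N : ℕ}

/-- The Markov game obtained from an MDP by adding a dummy adversary, whose action `i` adds `bᵢ` to
the reward and has no influence on the transitions. -/
def dummyGame (M : MDP S A) (b : Fin N → ℝ) : MarkovGame S A (Fin N) where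
  P s a _ s' := M.P s a s'
  P_nonneg s a _ s' := M.P_nonneg s a s'
  P_sum s a _ := M.P_sum s a
  r s a i s' := M.r s a s' + b i
  γ := M.γ
  γ_nonneg := M.γ_nonneg
  γ_lt_one := M.γ_lt_one

/-- The optimal Q-function `Qᵢ*` that corresponds to the `i`-th estimator. -/
def optQ (M : MDP S A) (b : Fin N → ℝ) (o : TurnOrder) (i : Fin N) : S → A → ℝ :=
  fun s a => (M.dummyGame b).optQ o s a i

end MDP

/-- The bootstrap value at the state `s'`: `max_a min_j Q_j(s', a)` in the maxmin version,
`min_j max_a Q_j(s', a)` in the minmax version. -/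
def bootstrap {S A : Type*} {N : ℕ} :
    TurnOrder → (Fin N → S → A → ℝ) → S → ℝ
  | .maxmin, Q, s' => ⨆ a : A, ⨅ j : Fin N, Q j s' a
  | .minmax, Q, s' => ⨅ j : Fin N, ⨆ a : A, Q j s' a

/-- The new value of `Qᵢ(s, a)` after the transition `(s, a, s')`, with step size `α`. -/
def daqEntry {S A : Type*} [Fintype S] {N : ℕ} (M : MDP S A) (b : Fin N → ℝ) (o : TurnOrder)
    (α : ℝ) (Q : Fin N → S → A → ℝ) (i : Fin N) (s : S) (a : A) (s' : S) : ℝ :=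
  Q i s a + α * (M.r s a s' + b i + M.γ * bootstrap o Q s' - Q i s a)

open Classical in
/-- One step of asynchronous DAQ for the sample `(s, a, i, s')`: only the entry `(s, a)` of the
`i`-th estimator is changed. -/
def daqAsyncStep {S A : Type*} [Fintype S] {N : ℕ} (M : MDP S A) (b : Fin N → ℝ) (o : TurnOrder)
    (α : ℝ) (Q : Fin N → S → A → ℝ) : S × A × Fin N × S → (Fin N → S → A → ℝ)
  | (s, a, i, s') => fun j x y =>
      if j = i ∧ x = s ∧ y = a then daqEntry M b o α Q i s a s' else Q j x y

open Classical in
/-- One step of synchronous DAQ for the sample `(s, a, s')`: the entry `(s, a)` of every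
estimator is changed. -/
def daqSyncStep {S A : Type*} [Fintype S] {N : ℕ} (M : MDP S A) (b : Fin N → ℝ) (o : TurnOrder)
    (α : ℝ) (Q : Fin N → S → A → ℝ) : S × A × S → (Fin N → S → A → ℝ)
  | (s, a, s') => fun j x y =>
      if x = s ∧ y = a then daqEntry M b o α Q j s a s' else Q j x y

/-- The estimators of asynchronous DAQ at step `t`, started in `Q₀` and driven by the samples `z`. -/
def daqAsync {S A : Type*} [Fintype S] {N : ℕ} (M : MDP S A) (b : Fin N → ℝ) (o : TurnOrder)
    (α : ℝ) (Q₀ : Fin N → S → A → ℝ) (z : ℕ → S × A × Fin N × S) : ℕ → (Fin N → S → A → ℝ)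
  | 0 => Q₀
  | t + 1 => daqAsyncStep M b o α (daqAsync M b o α Q₀ z t) (z t)

/-- The estimators of synchronous DAQ at step `t`, started in `Q₀` and driven by the samples `z`. -/
def daqSync {S A : Type*} [Fintype S] {N : ℕ} (M : MDP S A) (b : Fin N → ℝ) (o : TurnOrder)
    (α : ℝ) (Q₀ : Fin N → S → A → ℝ) (z : ℕ → S × A × S) : ℕ → (Fin N → S → A → ℝ)
  | 0 => Q₀
  | t + 1 => daqSyncStep M b o α (daqSync M b o α Q₀ z t) (z t)

/-- `Z 0, Z 1, …` are i.i.d. random variables in the discrete space `X` with point masses `law`. -/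
structure IsIIDSample {Ω X : Type*} [MeasurableSpace Ω] [MeasurableSpace X] (Pr : Measure Ω)
    (law : X → ℝ) (Z : ℕ → Ω → X) : Prop where
  measurable : ∀ t, Measurable (Z t)
  indep : iIndepFun Z Pr
  law_eq : ∀ t x, Pr.real (Z t ⁻¹' {x}) = law x

/-- The error bound at step `t`, with `m = |S × A|`, `N` estimators and
`ρ = 1 - α d_min (1 - γ)`. -/
def daqBound (γ α dmax dmin : ℝ) (m N t : ℕ) : ℝ :=
  let ρ : ℝ := 1 - α * dmin * (1 - γ)
  27 * dmax * m * N * α ^ (1 / 2 : ℝ) / (dmin ^ (3 / 2 : ℝ) * (1 - γ) ^ (5 / 2 : ℝ))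
    + 6 * (m : ℝ) ^ (3 / 2 : ℝ) * (N : ℝ) ^ (3 / 2 : ℝ) / (1 - γ) * ρ ^ t
    + 24 * γ * dmax * (m : ℝ) ^ (2 / 3 : ℝ) * (N : ℝ) ^ (2 / 3 : ℝ) / (1 - γ)
        * (3 / (dmin * (1 - γ))) * ρ ^ ((t : ℝ) / 2 - 1)

end

/-! Both versions of DAQ are random-coordinate stochastic approximation for the Bellman operator F
of the dummy game, on vectors indexed by (i, s, a). F is a γ-contraction in the sup norm, and its
fixed point is the optimal Q-function.

Let D be the diagonal of update probabilities. Split Q_t - Q* = x_t + n_t, where n_t collects the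
centered sampling noise through n_{t+1} = (1 - αD) n_t + α·noise. The noise cancels in x_t, so
pathwise ‖x_{t+1}‖ ≤ ρ‖x_t‖ + α d_max γ ‖n_t‖ (`norm_iter_sub_noiseAcc_succ_le`). The noise has
conditional mean zero and variance at most D_j times a constant, so each coordinate of n_t has
second moment O(α) uniformly in t (`integral_noiseAcc_sq_le`). Unrolling the recursion in
expectation leaves a term of order ρ^t and one of order √α (`integral_norm_iter_sub_le`). This is
stronger than the claimed bound, whose third term is not needed.

That the policy-defined optimal Q-function is the fixed point of F follows from a maximum principle
and greedy policies (`optQ_eq_of_bellman`). -/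

noncomputable section

/-! ### Averaging over a fresh sample that is independent of the past -/

section FiniteSamples

variable {Ω X : Type*} [MeasurableSpace Ω] {Pr : Measure Ω} [IsProbabilityMeasure Pr]
  [Finite X] [MeasurableSpace X] [DiscreteMeasurableSpace X]

theorem integrable_comp_of_finite {β : Type*} [Finite β] [MeasurableSpace β]
    [DiscreteMeasurableSpace β] {U : Ω → β} (hU : Measurable U) (g : β → ℝ) :
    Integrable (fun ω => g (U ω)) Pr := by
  obtain ⟨c, hc⟩ := (Set.finite_range fun x => ‖g x‖).bddAbove
  exact Integrable.of_bound ((Measurable.of_discrete (f := g)).comp hU).aestronglyMeasurable c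
    (.of_forall fun ω => hc ⟨U ω, rfl⟩)

/-- A function of an infinite sequence that only depends on the terms before `t`. -/
def DependsOnPast {X E : Type*} (t : ℕ) (f : (ℕ → X) → E) : Prop :=
  ∀ z z' : ℕ → X, (∀ k < t, z k = z' k) → f z = f z'

-- Padding a finite history with an arbitrary value gives the factorization. For finite `X` the
-- histories form a finite type, so measurability and boundedness become automatic.
omit [Finite X] [MeasurableSpace X] [DiscreteMeasurableSpace X] in
theorem DependsOnPast.exists_restrict [Nonempty X] {E : Type*} {t : ℕ} {f : (ℕ → X) → E}
    (hf : DependsOnPast t f) :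
    ∃ g : (Finset.range t → X) → E, ∀ z, f z = g fun k => z k := by
  classical
  refine ⟨fun u => f fun k => if h : k ∈ Finset.range t then u ⟨k, h⟩
    else Classical.arbitrary X, fun z => hf _ _ fun k hk => ?_⟩
  simp [hk]

theorem DependsOnPast.integrable {Z : ℕ → Ω → X} (hZ : ∀ t, Measurable (Z t)) {t : ℕ}
    {f : (ℕ → X) → ℝ} (hf : DependsOnPast t f) :
    Integrable (fun ω => f fun k => Z k ω) Pr := by
  have : Nonempty Ω := nonempty_of_isProbabilityMeasure Pr
  have : Nonempty X := ⟨Z 0 (Classical.arbitrary Ω)⟩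
  obtain ⟨g, hg⟩ := hf.exists_restrict
  simp_rw [hg]
  exact integrable_comp_of_finite
    (U := fun ω (k : Finset.range t) => Z k ω) (measurable_pi_lambda _ fun k => hZ k) g

/-- This plays the role of conditioning on the past. Writing f(·, Z t) as the sum over x of f(·, x)
times the indicator of Z t = x, each product factorizes by independence. -/
theorem integral_past_mul_present [Fintype X] {law : X → ℝ} {Z : ℕ → Ω → X}
    (hZ : IsIIDSample Pr law Z) {t : ℕ} {f : (ℕ → X) → X → ℝ}
    (hf : ∀ x, DependsOnPast t fun z => f z x) :
    ∫ ω, f (fun k => Z k ω) (Z t ω) ∂Pr = ∫ ω, ∑ x, law x * f (fun k => Z k ω) x ∂Pr := by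
  classical
  have : Nonempty Ω := nonempty_of_isProbabilityMeasure Pr
  have : Nonempty X := ⟨Z 0 (Classical.arbitrary Ω)⟩
  choose g hg using fun x => (hf x).exists_restrict
  have hU : Measurable fun ω (k : Finset.range t) => Z k ω :=
    measurable_pi_lambda _ fun k => hZ.measurable k
  have hind : IndepFun (fun ω (k : Finset.range t) => Z k ω) (Z t) Pr := by
    have h := hZ.indep.indepFun_finset (Finset.range t) {t} (by simp) hZ.measurable
    exact h.comp measurable_id (measurable_pi_apply (⟨t, by simp⟩ : ({t} : Finset ℕ)))
  have hint : ∀ x, Integrable (fun ω => law x * f (fun k => Z k ω) x) Pr := fun x =>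
    ((hf x).integrable hZ.measurable).const_mul _
  have hprod : ∀ x, ∫ ω, g x (fun k => Z k ω) * (if Z t ω = x then 1 else 0) ∂Pr
      = law x * ∫ ω, g x (fun k => Z k ω) ∂Pr := by
    intro x
    have hc := (hind.comp (φ := g x) (ψ := fun y => if y = x then (1 : ℝ) else 0)
      .of_discrete .of_discrete)
    have := hc.integral_fun_mul_eq_mul_integral
      (integrable_comp_of_finite hU (g x)).aestronglyMeasurable
      (integrable_comp_of_finite (hZ.measurable t)
        (fun y => if y = x then (1 : ℝ) else 0)).aestronglyMeasurable
    simp only [Function.comp_def] at this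
    rw [this, mul_comm]
    congr 1
    rw [← hZ.law_eq t x, ← integral_indicator_one (hZ.measurable t (.of_discrete))]
    rfl
  rw [integral_finsetSum _ fun x _ => hint x]
  simp_rw [integral_const_mul, hg, ← hprod]
  rw [← integral_finsetSum]
  · simp
  · intro x _
    exact integrable_comp_of_finite (U := fun ω => ((fun (k : Finset.range t) => Z k ω), Z t ω))
      (hU.prodMk (hZ.measurable t)) fun q => g x q.1 * (if q.2 = x then 1 else 0)

end FiniteSamples

/-! ### Random-coordinate stochastic approximation: pathwise estimates -/

/-- A random-coordinate stochastic approximation scheme with finitely many coordinates `J` and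
samples `X`. The sample `x` updates the coordinates `j` with `h x j = 1` towards the target
`T Q x j`, whose mean is `F Q j`. -/
structure RandomCoordScheme (J X : Type*) [Fintype J] [Fintype X] where
  law : X → ℝ
  law_nonneg : ∀ x, 0 ≤ law x
  law_sum : ∑ x, law x = 1
  h : X → J → ℝ
  h_eq : ∀ x j, h x j = 0 ∨ h x j = 1
  T : (J → ℝ) → X → J → ℝ
  F : (J → ℝ) → J → ℝ
  D : J → ℝ
  sum_h : ∀ j, ∑ x, law x * h x j = D j
  sum_h_T : ∀ Q j, ∑ x, law x * (h x j * T Q x j) = D j * F Q j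
  γ : ℝ
  γ_nonneg : 0 ≤ γ
  γ_lt_one : γ < 1
  F_lip : ∀ Q Q' j, |F Q j - F Q' j| ≤ γ * ‖Q - Q'‖
  R : ℝ
  R_nonneg : 0 ≤ R
  T_bound : ∀ Q x j, |T Q x j| ≤ R + γ * ‖Q‖
  F_bound : ∀ Q j, |F Q j| ≤ R + γ * ‖Q‖
  α : ℝ
  α_nonneg : 0 ≤ α
  α_le_one : α ≤ 1

namespace RandomCoordScheme

variable {J X : Type*} [Fintype J] [Fintype X] (C : RandomCoordScheme J X)

/-- The iterates of the scheme. -/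
def iter (Q₀ : J → ℝ) (z : ℕ → X) : ℕ → J → ℝ
  | 0 => Q₀
  | t + 1 => fun j => iter Q₀ z t j
      + C.α * (C.h (z t) j * (C.T (iter Q₀ z t) (z t) j - iter Q₀ z t j))

/-- The centered noise of the sample `x` at `Q`. -/
def noise (Q : J → ℝ) (x : X) (j : J) : ℝ :=
  C.h x j * (C.T Q x j - Q j) - C.D j * (C.F Q j - Q j)

/-- The noise accumulated by the scheme, discounted at the rate of the linear part. -/
def noiseAcc (Q₀ : J → ℝ) (z : ℕ → X) : ℕ → J → ℝ
  | 0 => 0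
  | t + 1 => fun j => (1 - C.α * C.D j) * noiseAcc Q₀ z t j
      + C.α * C.noise (C.iter Q₀ z t) (z t) j

/-- A bound for the temporal differences along the scheme. -/
def tdBound : ℝ := 2 * (C.R / (1 - C.γ))

theorem dependsOnPast_iter (Q₀ : J → ℝ) (t : ℕ) :
    DependsOnPast t fun z => C.iter Q₀ z t := by
  induction t with
  | zero => intro z z' _; rfl
  | succ t ih =>
    intro z z' h
    have h1 := ih z z' fun k hk => h k (hk.trans t.lt_succ_self)
    simp only at h1
    simp only [iter, h1, h t t.lt_succ_self]

theorem dependsOnPast_noiseAcc (Q₀ : J → ℝ) (t : ℕ) :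
    DependsOnPast t fun z => C.noiseAcc Q₀ z t := by
  induction t with
  | zero => intro z z' _; rfl
  | succ t ih =>
    intro z z' h
    have h1 := ih z z' fun k hk => h k (hk.trans t.lt_succ_self)
    have h2 := C.dependsOnPast_iter Q₀ t z z' fun k hk => h k (hk.trans t.lt_succ_self)
    simp only at h1 h2
    simp only [noiseAcc, h1, h2, h t t.lt_succ_self]

theorem one_sub_γ_pos : 0 < 1 - C.γ := by linarith [C.γ_lt_one]

theorem D_nonneg (j : J) : 0 ≤ C.D j := by
  rw [← C.sum_h j]
  refine Finset.sum_nonneg fun x _ => mul_nonneg (C.law_nonneg x) ?_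
  rcases C.h_eq x j with h | h <;> simp [h]

theorem D_le_one (j : J) : C.D j ≤ 1 := by
  rw [← C.sum_h j, ← C.law_sum]
  refine Finset.sum_le_sum fun x _ => ?_
  rcases C.h_eq x j with h | h <;> simp [h, C.law_nonneg]

/-- The radius R / (1 - γ) is the fixed point of c ↦ R + γc, so targets computed from a point of
this ball stay in it. -/
theorem R_div_fixed : C.R + C.γ * (C.R / (1 - C.γ)) = C.R / (1 - C.γ) := by
  have := C.one_sub_γ_pos
  field_simp
  ring

/-- An updated entry is a convex combination, with weights 1 - α and α, of the old entry and a
target, both in the ball. -/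
theorem norm_iter_le {Q₀ : J → ℝ} (h₀ : ‖Q₀‖ ≤ C.R / (1 - C.γ)) (z : ℕ → X) (t : ℕ) :
    ‖C.iter Q₀ z t‖ ≤ C.R / (1 - C.γ) := by
  have hK : 0 ≤ C.R / (1 - C.γ) := div_nonneg C.R_nonneg C.one_sub_γ_pos.le
  induction t with
  | zero => exact h₀
  | succ t ih =>
    refine (pi_norm_le_iff_of_nonneg hK).2 fun j => ?_
    have hj := (norm_le_pi_norm (C.iter Q₀ z t) j).trans ih
    rcases C.h_eq (z t) j with h | h
    · simpa [iter, h] using hj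
    · have hT := (C.T_bound (C.iter Q₀ z t) (z t) j).trans
        (add_le_add_right (mul_le_mul_of_nonneg_left ih C.γ_nonneg) _)
      rw [C.R_div_fixed] at hT
      simp only [iter, h, one_mul, Real.norm_eq_abs] at hj ⊢
      rw [abs_le] at hj hT ⊢
      have h1 := C.α_nonneg
      have h2 := sub_nonneg.2 C.α_le_one
      constructor <;> nlinarith

theorem norm_fixedPoint_le {Qs : J → ℝ} (hs : C.F Qs = Qs) : ‖Qs‖ ≤ C.R / (1 - C.γ) := by
  have h : ‖Qs‖ ≤ C.R + C.γ * ‖Qs‖ := by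
    refine (pi_norm_le_iff_of_nonneg
      (add_nonneg C.R_nonneg (mul_nonneg C.γ_nonneg (norm_nonneg _)))).2 fun j => ?_
    conv_lhs => rw [← hs]
    exact C.F_bound Qs j
  rw [le_div_iff₀ C.one_sub_γ_pos]
  linarith

theorem sum_law_noise (Q : J → ℝ) (j : J) : ∑ x, C.law x * C.noise Q x j = 0 := by
  have : ∀ x, C.law x * C.noise Q x j = C.law x * (C.h x j * C.T Q x j)
      - C.law x * C.h x j * Q j - C.law x * (C.D j * (C.F Q j - Q j)) := fun x => by
    unfold noise; ring
  simp_rw [this, Finset.sum_sub_distrib, ← Finset.sum_mul, C.sum_h_T, C.sum_h, C.law_sum]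
  ring

/-- The variance is at most the uncentered second moment, and the increment vanishes unless
coordinate j is sampled. The resulting factor D_j later offsets the contraction rate αD_j, so no
division by D_j occurs in the noise bound. -/
theorem sum_law_noise_sq_le {Q : J → ℝ} (hQ : ‖Q‖ ≤ C.R / (1 - C.γ)) (j : J) :
    ∑ x, C.law x * C.noise Q x j ^ 2 ≤ C.D j * C.tdBound ^ 2 := by
  set m := C.D j * (C.F Q j - Q j) with hm
  have h1 : ∀ x, C.law x * C.noise Q x j ^ 2
      = C.law x * (C.h x j * (C.T Q x j - Q j)) ^ 2
        - 2 * m * (C.law x * C.noise Q x j) - C.law x * m ^ 2 := fun x => by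
    unfold noise; rw [← hm]; ring
  have h2 : ∀ x, C.law x * (C.h x j * (C.T Q x j - Q j)) ^ 2
      ≤ C.law x * C.h x j * C.tdBound ^ 2 := fun x => by
    rcases C.h_eq x j with h | h
    · simp [h]
    · rw [h, one_mul, mul_one]
      refine mul_le_mul_of_nonneg_left (sq_le_sq' ?_ ?_) (C.law_nonneg x)
      all_goals
        have hj := (norm_le_pi_norm Q j).trans hQ
        have hT := (C.T_bound Q x j).trans
          (add_le_add_right (mul_le_mul_of_nonneg_left hQ C.γ_nonneg) _)
        rw [C.R_div_fixed] at hT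
        rw [Real.norm_eq_abs] at hj
        rw [abs_le] at hj hT
        unfold tdBound
        linarith
  simp_rw [h1, Finset.sum_sub_distrib, ← Finset.mul_sum, C.sum_law_noise, ← Finset.sum_mul,
    C.law_sum]
  have := Finset.sum_le_sum fun x (_ : x ∈ Finset.univ) => h2 x
  rw [← Finset.sum_mul, C.sum_h] at this
  nlinarith [sq_nonneg m]

theorem norm_iter_sub_noiseAcc_succ_le {Qs : J → ℝ} (hs : C.F Qs = Qs) {dmax dmin : ℝ}
    (hmax : ∀ j, C.D j ≤ dmax) (hmin : ∀ j, dmin ≤ C.D j)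
    [Nonempty J] (Q₀ : J → ℝ) (z : ℕ → X) (t : ℕ) :
    ‖C.iter Q₀ z (t + 1) - Qs - C.noiseAcc Q₀ z (t + 1)‖
      ≤ (1 - C.α * dmin * (1 - C.γ)) * ‖C.iter Q₀ z t - Qs - C.noiseAcc Q₀ z t‖
        + C.α * dmax * C.γ * ‖C.noiseAcc Q₀ z t‖ := by
  refine (pi_norm_le_iff_of_nonempty _).2 fun j => ?_
  set Q := C.iter Q₀ z t
  set n := C.noiseAcc Q₀ z t
  -- The noise cancels because the accumulated noise evolves with the same linear part 1 - αD_j;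
  -- only the mean drift remains.
  have hj : (C.iter Q₀ z (t + 1) - Qs - C.noiseAcc Q₀ z (t + 1)) j
      = (1 - C.α * C.D j) * (Q - Qs - n) j + C.α * C.D j * (C.F Q j - C.F Qs j) := by
    simp only [Pi.sub_apply, iter, noiseAcc, noise]
    rw [hs]
    ring
  have hx : |(Q - Qs - n) j| ≤ ‖Q - Qs - n‖ := norm_le_pi_norm (Q - Qs - n) j
  have hF : |C.F Q j - C.F Qs j| ≤ C.γ * (‖Q - Qs - n‖ + ‖n‖) :=
    (C.F_lip Q Qs j).trans (mul_le_mul_of_nonneg_left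
      (by simpa using norm_add_le (Q - Qs - n) n) C.γ_nonneg)
  have hα := C.α_nonneg
  have hD := C.D_nonneg j
  have hx₁ : 0 ≤ 1 - C.α * C.D j :=
    sub_nonneg.2 (mul_le_one₀ C.α_le_one (C.D_nonneg j) (C.D_le_one j))
  have hγ := C.γ_nonneg
  have hγ' := C.one_sub_γ_pos.le
  rw [hj, Real.norm_eq_abs]
  calc |(1 - C.α * C.D j) * (Q - Qs - n) j + C.α * C.D j * (C.F Q j - C.F Qs j)|
      ≤ (1 - C.α * C.D j) * |(Q - Qs - n) j| + C.α * C.D j * |C.F Q j - C.F Qs j| := by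
        refine (abs_add_le _ _).trans_eq ?_
        rw [abs_mul, abs_mul, abs_of_nonneg hx₁, abs_of_nonneg (mul_nonneg hα hD)]
    _ ≤ (1 - C.α * C.D j) * ‖Q - Qs - n‖
          + C.α * C.D j * (C.γ * (‖Q - Qs - n‖ + ‖n‖)) := by gcongr
    _ = (1 - C.α * C.D j * (1 - C.γ)) * ‖Q - Qs - n‖ + C.α * C.D j * C.γ * ‖n‖ := by ring
    _ ≤ _ := by
        gcongr
        · exact hmin j
        · exact hmax j

/-! ### Moments of the accumulated noise and the mean error -/

section Probability

variable {Ω : Type*} [MeasurableSpace Ω] {Pr : Measure Ω} [IsProbabilityMeasure Pr]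
  [MeasurableSpace X] [DiscreteMeasurableSpace X] {Z : ℕ → Ω → X}

theorem integral_noiseAcc_sq_le (hZ : IsIIDSample Pr C.law Z) {Q₀ : J → ℝ}
    (h₀ : ‖Q₀‖ ≤ C.R / (1 - C.γ)) (t : ℕ) (j : J) :
    ∫ ω, C.noiseAcc Q₀ (fun k => Z k ω) t j ^ 2 ∂Pr ≤ C.α * C.tdBound ^ 2 := by
  induction t with
  | zero => simpa [noiseAcc] using mul_nonneg C.α_nonneg (sq_nonneg _)
  | succ t ih =>
    -- The next squared noise as a function of the past and the fresh sample. Averaging over x kills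
    -- the cross term, as the noise has mean zero.
    set f : (ℕ → X) → X → ℝ := fun z x =>
      ((1 - C.α * C.D j) * C.noiseAcc Q₀ z t j + C.α * C.noise (C.iter Q₀ z t) x j) ^ 2 with hf
    have hfd : ∀ x, DependsOnPast t fun z => f z x := fun x z z' h => by
      have h1 := C.dependsOnPast_iter Q₀ t z z' h
      have h2 := C.dependsOnPast_noiseAcc Q₀ t z z' h
      simp only at h1 h2
      simp only [hf, h1, h2]
    have hNi : Integrable (fun ω => C.noiseAcc Q₀ (fun k => Z k ω) t j ^ 2) Pr :=
      DependsOnPast.integrable (f := fun z => C.noiseAcc Q₀ z t j ^ 2) hZ.measurable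
        fun z z' h => by
          have h2 := C.dependsOnPast_noiseAcc Q₀ t z z' h
          simp only at h2
          simp only [h2]
    have hstep : ∀ z, ∑ x, C.law x * f z x ≤ (1 - C.α * C.D j) ^ 2 * C.noiseAcc Q₀ z t j ^ 2
        + C.α ^ 2 * (C.D j * C.tdBound ^ 2) := fun z => by
      have h1 : ∀ x, C.law x * f z x
          = C.law x * ((1 - C.α * C.D j) ^ 2 * C.noiseAcc Q₀ z t j ^ 2)
          + 2 * (1 - C.α * C.D j) * C.noiseAcc Q₀ z t j * C.α
              * (C.law x * C.noise (C.iter Q₀ z t) x j)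
          + C.α ^ 2 * (C.law x * C.noise (C.iter Q₀ z t) x j ^ 2) := fun x => by
        simp only [hf]; ring
      simp_rw [h1, Finset.sum_add_distrib, ← Finset.mul_sum, ← Finset.sum_mul, C.law_sum,
        C.sum_law_noise]
      have := mul_le_mul_of_nonneg_left
        (C.sum_law_noise_sq_le (C.norm_iter_le h₀ z t) j) (sq_nonneg C.α)
      linarith
    calc ∫ ω, C.noiseAcc Q₀ (fun k => Z k ω) (t + 1) j ^ 2 ∂Pr
        = ∫ ω, ∑ x, C.law x * f (fun k => Z k ω) x ∂Pr := integral_past_mul_present hZ hfd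
      _ ≤ ∫ ω, ((1 - C.α * C.D j) ^ 2 * C.noiseAcc Q₀ (fun k => Z k ω) t j ^ 2
            + C.α ^ 2 * (C.D j * C.tdBound ^ 2)) ∂Pr := by
          refine integral_mono ?_ ((hNi.const_mul _).add (integrable_const _))
            fun ω => hstep fun k => Z k ω
          exact integrable_finsetSum _ fun x _ => ((hfd x).integrable hZ.measurable).const_mul _
      _ = (1 - C.α * C.D j) ^ 2 * ∫ ω, C.noiseAcc Q₀ (fun k => Z k ω) t j ^ 2 ∂Pr
            + C.α ^ 2 * (C.D j * C.tdBound ^ 2) := by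
          rw [integral_add (hNi.const_mul _) (integrable_const _), integral_const_mul]
          simp
      _ ≤ (1 - C.α * C.D j) ^ 2 * (C.α * C.tdBound ^ 2)
            + C.α ^ 2 * (C.D j * C.tdBound ^ 2) := by gcongr
      -- With y = αD_j this is (1 - y)² + y = 1 - y(1 - y), which is at most 1 because y lies in [0,
      -- 1].
      _ = C.α * C.tdBound ^ 2 * (1 - C.α * C.D j * (1 - C.α * C.D j)) := by ring
      _ ≤ C.α * C.tdBound ^ 2 * 1 := by
          have hx₀ : 0 ≤ C.α * C.D j := mul_nonneg C.α_nonneg (C.D_nonneg j)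
          have hx₁ : C.α * C.D j ≤ 1 := mul_le_one₀ C.α_le_one (C.D_nonneg j) (C.D_le_one j)
          refine mul_le_mul_of_nonneg_left ?_ (mul_nonneg C.α_nonneg (sq_nonneg _))
          nlinarith
      _ = C.α * C.tdBound ^ 2 := mul_one _

theorem integrable_norm_noiseAcc (hZ : IsIIDSample Pr C.law Z) (Q₀ : J → ℝ) (t : ℕ) :
    Integrable (fun ω => ‖C.noiseAcc Q₀ (fun k => Z k ω) t‖) Pr :=
  DependsOnPast.integrable (f := fun z => ‖C.noiseAcc Q₀ z t‖) hZ.measurable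
    fun z z' h => congrArg norm (C.dependsOnPast_noiseAcc Q₀ t z z' h)

/-- The squared sup norm is at most the sum of squares, so coordinatewise second moments suffice; no
independence between coordinates is needed. -/
theorem integral_norm_noiseAcc_le (hZ : IsIIDSample Pr C.law Z) {Q₀ : J → ℝ}
    (h₀ : ‖Q₀‖ ≤ C.R / (1 - C.γ)) (t : ℕ) :
    ∫ ω, ‖C.noiseAcc Q₀ (fun k => Z k ω) t‖ ∂Pr
      ≤ √(C.α * Fintype.card J) * C.tdBound := by
  have htd : 0 ≤ C.tdBound :=
    mul_nonneg zero_le_two (div_nonneg C.R_nonneg C.one_sub_γ_pos.le)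
  have hi : ∀ j, Integrable (fun ω => C.noiseAcc Q₀ (fun k => Z k ω) t j ^ 2) Pr := fun j =>
    DependsOnPast.integrable (f := fun z => C.noiseAcc Q₀ z t j ^ 2) hZ.measurable
      fun z z' h => by
        have h2 := C.dependsOnPast_noiseAcc Q₀ t z z' h
        simp only at h2
        simp only [h2]
  have hn2 : Integrable (fun ω => ‖C.noiseAcc Q₀ (fun k => Z k ω) t‖ ^ 2) Pr :=
    DependsOnPast.integrable (f := fun z => ‖C.noiseAcc Q₀ z t‖ ^ 2) hZ.measurable
      fun z z' h => congrArg (fun v => ‖v‖ ^ 2) (C.dependsOnPast_noiseAcc Q₀ t z z' h)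
  -- Jensen's inequality for the square, obtained from the nonnegativity of the variance.
  have hsq : (∫ ω, ‖C.noiseAcc Q₀ (fun k => Z k ω) t‖ ∂Pr) ^ 2
      ≤ ∫ ω, ‖C.noiseAcc Q₀ (fun k => Z k ω) t‖ ^ 2 ∂Pr := by
    set m := ∫ ω, ‖C.noiseAcc Q₀ (fun k => Z k ω) t‖ ∂Pr with hm
    have h : 0 ≤ ∫ ω, (‖C.noiseAcc Q₀ (fun k => Z k ω) t‖ ^ 2
        - 2 * m * ‖C.noiseAcc Q₀ (fun k => Z k ω) t‖ + m ^ 2) ∂Pr :=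
      integral_nonneg fun ω => by
        have := sq_nonneg (‖C.noiseAcc Q₀ (fun k => Z k ω) t‖ - m)
        simp only [Pi.zero_apply]
        linarith
    have hl := (C.integrable_norm_noiseAcc hZ Q₀ t).const_mul (2 * m)
    rw [integral_add (f := fun ω => ‖C.noiseAcc Q₀ (fun k => Z k ω) t‖ ^ 2
        - 2 * m * ‖C.noiseAcc Q₀ (fun k => Z k ω) t‖) (hn2.sub hl) (integrable_const _),
      integral_sub hn2 hl,
      integral_const_mul, ← hm] at h
    simp at h
    linarith
  have hsum : ∫ ω, ‖C.noiseAcc Q₀ (fun k => Z k ω) t‖ ^ 2 ∂Pr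
      ≤ Fintype.card J * (C.α * C.tdBound ^ 2) := by
    calc ∫ ω, ‖C.noiseAcc Q₀ (fun k => Z k ω) t‖ ^ 2 ∂Pr
        ≤ ∫ ω, ∑ j, C.noiseAcc Q₀ (fun k => Z k ω) t j ^ 2 ∂Pr := by
          refine integral_mono hn2 (integrable_finsetSum _ fun j _ => hi j) fun ω => ?_
          have hs : 0 ≤ ∑ j, C.noiseAcc Q₀ (fun k => Z k ω) t j ^ 2 :=
            Finset.sum_nonneg fun j _ => sq_nonneg _
          refine (Real.le_sqrt (norm_nonneg _) hs).1 ?_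
          refine (pi_norm_le_iff_of_nonneg (Real.sqrt_nonneg _)).2 fun j => ?_
          exact Real.abs_le_sqrt (Finset.single_le_sum
            (f := fun j => C.noiseAcc Q₀ (fun k => Z k ω) t j ^ 2)
            (fun j _ => sq_nonneg _) (Finset.mem_univ j))
      _ = ∑ j, ∫ ω, C.noiseAcc Q₀ (fun k => Z k ω) t j ^ 2 ∂Pr :=
          integral_finsetSum _ fun j _ => hi j
      _ ≤ ∑ _j : J, C.α * C.tdBound ^ 2 :=
          Finset.sum_le_sum fun j _ => C.integral_noiseAcc_sq_le hZ h₀ t j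
      _ = Fintype.card J * (C.α * C.tdBound ^ 2) := by simp
  refine abs_le_of_sq_le_sq' ?_ (mul_nonneg (Real.sqrt_nonneg _) htd) |>.2
  rw [mul_pow, Real.sq_sqrt (mul_nonneg C.α_nonneg (Nat.cast_nonneg _))]
  linarith

theorem integrable_norm_iter_sub (hZ : IsIIDSample Pr C.law Z) (Q₀ Qs : J → ℝ) (t : ℕ) :
    Integrable (fun ω => ‖C.iter Q₀ (fun k => Z k ω) t - Qs‖) Pr :=
  DependsOnPast.integrable (f := fun z => ‖C.iter Q₀ z t - Qs‖) hZ.measurable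
    fun z z' h => congrArg (fun v => ‖v - Qs‖) (C.dependsOnPast_iter Q₀ t z z' h)

/-- The error of the scheme decays geometrically, up to a term of order `√α`. -/
theorem integral_norm_iter_sub_le [Nonempty J] (hZ : IsIIDSample Pr C.law Z) {Q₀ Qs : J → ℝ}
    (hs : C.F Qs = Qs) (h₀ : ‖Q₀‖ ≤ C.R / (1 - C.γ)) {dmax dmin : ℝ}
    (hmax : ∀ j, C.D j ≤ dmax) (hmin : ∀ j, dmin ≤ C.D j) (hmin₀ : 0 < dmin) (t : ℕ) :
    ∫ ω, ‖C.iter Q₀ (fun k => Z k ω) t - Qs‖ ∂Pr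
      ≤ C.tdBound * (1 - C.α * dmin * (1 - C.γ)) ^ t
        + dmax / (dmin * (1 - C.γ)) * (√(C.α * Fintype.card J) * C.tdBound) := by
  have hγ := C.one_sub_γ_pos
  have hγ₀ := C.γ_nonneg
  have hα := C.α_nonneg
  obtain ⟨j₀⟩ := ‹Nonempty J›
  have : Nonempty J := ⟨j₀⟩
  have hmm : dmin ≤ dmax := (hmin j₀).trans (hmax j₀)
  have hmin₁ : dmin ≤ 1 := (hmin j₀).trans (C.D_le_one j₀)
  set B := √(C.α * Fintype.card J) * C.tdBound with hB
  set ρ := 1 - C.α * dmin * (1 - C.γ) with hρ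
  have hρ₀ : 0 ≤ ρ := sub_nonneg.2 (mul_le_one₀
    (mul_le_one₀ C.α_le_one hmin₀.le hmin₁) hγ.le (by linarith))
  have htd : 0 ≤ C.tdBound := mul_nonneg zero_le_two (div_nonneg C.R_nonneg hγ.le)
  have hB₀ : 0 ≤ B := mul_nonneg (Real.sqrt_nonneg _) htd
  have hxi : ∀ t, Integrable (fun ω =>
      ‖C.iter Q₀ (fun k => Z k ω) t - Qs - C.noiseAcc Q₀ (fun k => Z k ω) t‖) Pr := fun t =>
    DependsOnPast.integrable (f := fun z => ‖C.iter Q₀ z t - Qs - C.noiseAcc Q₀ z t‖)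
      hZ.measurable fun z z' h => by
        have h1 := C.dependsOnPast_iter Q₀ t z z' h
        have h2 := C.dependsOnPast_noiseAcc Q₀ t z z' h
        simp only at h1 h2
        simp only [h1, h2]
  have hni := C.integrable_norm_noiseAcc hZ Q₀
  have hnB := C.integral_norm_noiseAcc_le hZ h₀
  -- The constant term is the fixed point of c ↦ ρc + α d_max γ B, since 1 - ρ = α d_min (1 - γ).
  have hx : ∫ ω, ‖C.iter Q₀ (fun k => Z k ω) t - Qs - C.noiseAcc Q₀ (fun k => Z k ω) t‖ ∂Pr
      ≤ C.tdBound * ρ ^ t + dmax * C.γ / (dmin * (1 - C.γ)) * B := by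
    induction t with
    | zero =>
      have h1 : ‖Q₀ - Qs‖ ≤ C.tdBound :=
        (norm_sub_le _ _).trans (by unfold tdBound; linarith [C.norm_fixedPoint_le hs])
      have h2 : 0 ≤ dmax * C.γ / (dmin * (1 - C.γ)) * B := by
        have := hmin₀.le.trans hmm
        positivity
      simp only [iter, noiseAcc, sub_zero, integral_const, pow_zero, mul_one]
      simp only [probReal_univ, one_smul]
      linarith
    | succ t ih =>
      calc ∫ ω, ‖C.iter Q₀ (fun k => Z k ω) (t + 1) - Qs
              - C.noiseAcc Q₀ (fun k => Z k ω) (t + 1)‖ ∂Pr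
          ≤ ∫ ω, (ρ * ‖C.iter Q₀ (fun k => Z k ω) t - Qs - C.noiseAcc Q₀ (fun k => Z k ω) t‖
              + C.α * dmax * C.γ * ‖C.noiseAcc Q₀ (fun k => Z k ω) t‖) ∂Pr :=
            integral_mono (hxi _) (((hxi t).const_mul _).add ((hni t).const_mul _)) fun ω =>
              C.norm_iter_sub_noiseAcc_succ_le hs hmax hmin Q₀ _ t
        _ = ρ * ∫ ω, ‖C.iter Q₀ (fun k => Z k ω) t - Qs
                - C.noiseAcc Q₀ (fun k => Z k ω) t‖ ∂Pr
              + C.α * dmax * C.γ * ∫ ω, ‖C.noiseAcc Q₀ (fun k => Z k ω) t‖ ∂Pr := by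
            rw [integral_add ((hxi t).const_mul _) ((hni t).const_mul _), integral_const_mul,
              integral_const_mul]
        _ ≤ ρ * (C.tdBound * ρ ^ t + dmax * C.γ / (dmin * (1 - C.γ)) * B)
              + C.α * dmax * C.γ * B := by
            have := hmin₀.le.trans hmm
            gcongr
            exact hnB t
        _ = C.tdBound * ρ ^ (t + 1) + dmax * C.γ / (dmin * (1 - C.γ)) * B := by
            rw [hρ]
            field_simp
            ring
  calc ∫ ω, ‖C.iter Q₀ (fun k => Z k ω) t - Qs‖ ∂Pr
      ≤ ∫ ω, (‖C.iter Q₀ (fun k => Z k ω) t - Qs - C.noiseAcc Q₀ (fun k => Z k ω) t‖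
          + ‖C.noiseAcc Q₀ (fun k => Z k ω) t‖) ∂Pr :=
        integral_mono (C.integrable_norm_iter_sub hZ Q₀ Qs t) ((hxi t).add (hni t)) fun ω => by
          simpa using norm_add_le (C.iter Q₀ (fun k => Z k ω) t - Qs
            - C.noiseAcc Q₀ (fun k => Z k ω) t) (C.noiseAcc Q₀ (fun k => Z k ω) t)
    _ ≤ C.tdBound * ρ ^ t + dmax * C.γ / (dmin * (1 - C.γ)) * B + B := by
        rw [integral_add (hxi t) (hni t)]
        exact add_le_add hx (hnB t)
    _ ≤ C.tdBound * ρ ^ t + dmax / (dmin * (1 - C.γ)) * B := by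
        -- Dropping the factor γ frees (d_max / d_min) B, which absorbs the extra B.
        have h1 : 1 ≤ dmax / dmin := (one_le_div hmin₀).2 hmm
        have h2 : dmax / (dmin * (1 - C.γ)) * B - dmax * C.γ / (dmin * (1 - C.γ)) * B
            = dmax / dmin * B := by
          field_simp
        have h3 := mul_le_mul_of_nonneg_right h1 hB₀
        linarith

end Probability

end RandomCoordScheme

/-! ### Finite maxima and minima are nonexpansive in the sup norm -/

section FiniteExtrema

variable {ι : Type*} [Finite ι] [Nonempty ι]

theorem abs_ciSup_le_of_finite {f : ι → ℝ} {c : ℝ} (h : ∀ i, |f i| ≤ c) : |⨆ i, f i| ≤ c := by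
  obtain ⟨i, hi⟩ := exists_eq_ciSup_of_finite (f := f)
  exact hi ▸ h i

theorem abs_ciInf_le_of_finite {f : ι → ℝ} {c : ℝ} (h : ∀ i, |f i| ≤ c) : |⨅ i, f i| ≤ c := by
  obtain ⟨i, hi⟩ := exists_eq_ciInf_of_finite (f := f)
  exact hi ▸ h i

theorem abs_ciSup_sub_ciSup_le_of_finite {f g : ι → ℝ} {c : ℝ} (h : ∀ i, |f i - g i| ≤ c) :
    |(⨆ i, f i) - ⨆ i, g i| ≤ c := by
  have key : ∀ {f g : ι → ℝ}, (∀ i, |f i - g i| ≤ c) → (⨆ i, f i) ≤ (⨆ i, g i) + c :=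
    fun {f g} h => ciSup_le fun i => by
      have h1 := (abs_le.1 (h i)).2
      have h2 := le_ciSup (Set.finite_range g).bddAbove i
      linarith
  have h1 := key h
  have h2 := key fun i => (abs_sub_comm (g i) (f i)).trans_le (h i)
  rw [abs_le]
  constructor <;> linarith

theorem abs_ciInf_sub_ciInf_le_of_finite {f g : ι → ℝ} {c : ℝ} (h : ∀ i, |f i - g i| ≤ c) :
    |(⨅ i, f i) - ⨅ i, g i| ≤ c := by
  have key : ∀ {f g : ι → ℝ}, (∀ i, |f i - g i| ≤ c) → (⨅ i, f i) - c ≤ ⨅ i, g i :=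
    fun {f g} h => le_ciInf fun i => by
      have h1 := (abs_le.1 (h i)).2
      have h2 := ciInf_le (Set.finite_range f).bddBelow i
      linarith
  have h1 := key h
  have h2 := key fun i => (abs_sub_comm (g i) (f i)).trans_le (h i)
  rw [abs_le]
  constructor <;> linarith

end FiniteExtrema

/-! ### Bellman equations of the alternating Markov game -/

namespace MarkovGame

variable {S A B : Type*} [Fintype S] (G : MarkovGame S A B)

theorem sum_P_mul_le {f : S → ℝ} {c : ℝ} (h : ∀ x, f x ≤ c) (s : S) (a : A) (b : B) :
    ∑ s', G.P s a b s' * f s' ≤ c := by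
  calc ∑ s', G.P s a b s' * f s' ≤ ∑ s', G.P s a b s' * c :=
        Finset.sum_le_sum fun s' _ => mul_le_mul_of_nonneg_left (h s') (G.P_nonneg s a b s')
    _ = c := by rw [← Finset.sum_mul, G.P_sum, one_mul]

theorem abs_sum_P_mul_le {f : S → ℝ} {c : ℝ} (h : ∀ x, |f x| ≤ c) (s : S) (a : A) (b : B) :
    |∑ s', G.P s a b s' * f s'| ≤ c := by
  refine abs_le.2 ⟨?_, G.sum_P_mul_le (fun x => (abs_le.1 (h x)).2) s a b⟩
  have := G.sum_P_mul_le (fun x => neg_le.1 (abs_le.1 (h x)).1) s a b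
  simp only [mul_neg, Finset.sum_neg_distrib] at this
  linarith

theorem sum_P_mul_mono {V W : S → ℝ} (h : ∀ x, V x ≤ W x) (s : S) (a : A) (b : B) :
    ∑ s', G.P s a b s' * (G.r s a b s' + G.γ * V s')
      ≤ ∑ s', G.P s a b s' * (G.r s a b s' + G.γ * W s') :=
  Finset.sum_le_sum fun s' _ => mul_le_mul_of_nonneg_left
    (add_le_add_right (mul_le_mul_of_nonneg_left (h s') G.γ_nonneg) _) (G.P_nonneg s a b s')

variable [Finite A] [Finite B]

theorem exists_abs_expReward_le (g : S → A × B) :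
    ∃ c, ∀ t s a b, |G.expReward g t s a b| ≤ c := by
  obtain ⟨c, hc⟩ := (Set.finite_range fun p : S × A × B =>
    |G.expReward g 0 p.1 p.2.1 p.2.2|).bddAbove
  refine ⟨c, fun t => ?_⟩
  induction t with
  | zero => exact fun s a b => hc ⟨(s, a, b), rfl⟩
  | succ t ih => exact fun s a b => G.abs_sum_P_mul_le (fun x => ih x _ _) s a b

theorem summable_expReward (g : S → A × B) (s : S) (a : A) (b : B) :
    Summable fun t : ℕ => G.γ ^ t * G.expReward g t s a b := by
  obtain ⟨c, hc⟩ := G.exists_abs_expReward_le g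
  refine Summable.of_norm_bounded
    ((summable_geometric_of_lt_one G.γ_nonneg G.γ_lt_one).mul_right c) fun t => ?_
  rw [norm_mul, Real.norm_of_nonneg (pow_nonneg G.γ_nonneg t)]
  exact mul_le_mul_of_nonneg_left (hc t s a b) (pow_nonneg G.γ_nonneg t)

/-- The Bellman equation of a stationary pair of policies. -/
theorem policyQ_eq (g : S → A × B) (s : S) (a : A) (b : B) :
    G.policyQ g s a b
      = ∑ s', G.P s a b s' * (G.r s a b s' + G.γ * G.policyQ g s' (g s').1 (g s').2) := by
  rw [policyQ, (G.summable_expReward g s a b).tsum_eq_zero_add]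
  have h : ∀ t : ℕ, G.γ ^ (t + 1) * G.expReward g (t + 1) s a b
      = ∑ s', G.P s a b s' * G.γ * (G.γ ^ t * G.expReward g t s' (g s').1 (g s').2) := fun t => by
    simp only [expReward, Finset.mul_sum]
    exact Finset.sum_congr rfl fun s' _ => by ring
  simp_rw [h]
  rw [Summable.tsum_finsetSum fun s' _ => (G.summable_expReward g s' _ _).mul_left _]
  simp_rw [tsum_mul_left]
  simp only [pow_zero, one_mul, expReward, ← Finset.sum_add_distrib]
  exact Finset.sum_congr rfl fun s' _ => by unfold policyQ; ring

/-- Maximum principle: at a maximizer, D is at most γ times its own maximum, which forces the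
maximum to be nonpositive as γ < 1. -/
theorem nonpos_of_le_discounted {D : S → A → B → ℝ} (g : S → A × B)
    (h : ∀ s a b, D s a b ≤ ∑ s', G.P s a b s' * (G.γ * D s' (g s').1 (g s').2))
    (s : S) (a : A) (b : B) : D s a b ≤ 0 := by
  have : Nonempty (S × A × B) := ⟨(s, a, b)⟩
  obtain ⟨p, hp⟩ := Finite.exists_max fun p : S × A × B => D p.1 p.2.1 p.2.2
  have h1 : D p.1 p.2.1 p.2.2 ≤ G.γ * D p.1 p.2.1 p.2.2 :=
    (h _ _ _).trans (G.sum_P_mul_le (fun x => mul_le_mul_of_nonneg_left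
      (hp (x, (g x).1, (g x).2)) G.γ_nonneg) _ _ _)
  have h2 := hp (s, a, b)
  simp only at h2
  nlinarith [G.γ_lt_one]

/-- A supersolution of the policy's Bellman equation dominates its value: the difference obeys the
maximum principle. -/
theorem policyQ_le {Q : S → A → B → ℝ} (g : S → A × B)
    (h : ∀ s a b, ∑ s', G.P s a b s' * (G.r s a b s' + G.γ * Q s' (g s').1 (g s').2) ≤ Q s a b)
    (s : S) (a : A) (b : B) : G.policyQ g s a b ≤ Q s a b := by
  refine sub_nonpos.1 (G.nonpos_of_le_discounted
    (D := fun s a b => G.policyQ g s a b - Q s a b) g (fun s a b => ?_) s a b)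
  have h1 := h s a b
  have h2 := G.policyQ_eq g s a b
  have h3 : ∑ s', G.P s a b s' * (G.γ * (G.policyQ g s' (g s').1 (g s').2 - Q s' (g s').1 (g s').2))
      = ∑ s', G.P s a b s' * (G.r s a b s' + G.γ * G.policyQ g s' (g s').1 (g s').2)
        - ∑ s', G.P s a b s' * (G.r s a b s' + G.γ * Q s' (g s').1 (g s').2) := by
    rw [← Finset.sum_sub_distrib]
    exact Finset.sum_congr rfl fun s' _ => by ring
  linarith

theorem le_policyQ {Q : S → A → B → ℝ} (g : S → A × B)
    (h : ∀ s a b, Q s a b ≤ ∑ s', G.P s a b s' * (G.r s a b s' + G.γ * Q s' (g s').1 (g s').2))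
    (s : S) (a : A) (b : B) : Q s a b ≤ G.policyQ g s a b := by
  refine sub_nonpos.1 (G.nonpos_of_le_discounted
    (D := fun s a b => Q s a b - G.policyQ g s a b) g (fun s a b => ?_) s a b)
  have h1 := h s a b
  have h2 := G.policyQ_eq g s a b
  have h3 : ∑ s', G.P s a b s' * (G.γ * (Q s' (g s').1 (g s').2 - G.policyQ g s' (g s').1 (g s').2))
      = ∑ s', G.P s a b s' * (G.r s a b s' + G.γ * Q s' (g s').1 (g s').2)
        - ∑ s', G.P s a b s' * (G.r s a b s' + G.γ * G.policyQ g s' (g s').1 (g s').2) := by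
    rw [← Finset.sum_sub_distrib]
    exact Finset.sum_congr rfl fun s' _ => by ring
  linarith

/-- The value at the state `s'` of the one-shot alternating game with payoff `Q s'`. -/
def gameValue (o : TurnOrder) (Q : S → A → B → ℝ) (s' : S) : ℝ :=
  match o with
  | .maxmin => ⨆ a : A, ⨅ b : B, Q s' a b
  | .minmax => ⨅ b : B, ⨆ a : A, Q s' a b

variable [Nonempty A] [Nonempty B]

/-- A solution of the Bellman optimality equation is the optimal Q-function. -/
theorem optQ_eq_of_bellman (o : TurnOrder) {Q : S → A → B → ℝ}
    (hQ : ∀ s a b, Q s a b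
      = ∑ s', G.P s a b s' * (G.r s a b s' + G.γ * gameValue o Q s')) :
    G.optQ o = Q := by
  funext s a b
  cases o with
  | maxmin =>
    have hmin : ∀ x a', ∃ b', Q x a' b' = ⨅ b, Q x a' b := fun x a' => exists_eq_ciInf_of_finite
    choose ν hν using hmin
    have hmax : ∀ x, ∃ a', ⨅ b, Q x a' b = ⨆ a', ⨅ b, Q x a' b := fun x =>
      exists_eq_ciSup_of_finite (f := fun a' => ⨅ b, Q x a' b)
    choose π hπ using hmax
    refine le_antisymm (ciSup_le fun π' => ?_) ?_
    -- The adversary's best reply ν makes Q a supersolution against every π'.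
    · refine (ciInf_le (Set.finite_range _).bddBelow ν).trans
        (G.policyQ_le _ (fun s a b => ?_) s a b)
      rw [hQ s a b]
      exact G.sum_P_mul_mono (fun x => (hν x (π' x)).trans_le
        (le_ciSup (f := fun a' => ⨅ b, Q x a' b) (Set.finite_range _).bddAbove (π' x))) s a b
    -- The greedy π makes Q a subsolution whatever the reply ν'.
    · refine le_ciSup_of_le (Set.finite_range _).bddAbove π (le_ciInf fun ν' => ?_)
      refine G.le_policyQ _ (fun s a b => ?_) s a b
      rw [hQ s a b]
      exact G.sum_P_mul_mono (fun x => (hπ x).ge.trans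
        (ciInf_le (Set.finite_range _).bddBelow (ν' x (π x)))) s a b
  | minmax =>
    have hmax : ∀ x b', ∃ a', Q x a' b' = ⨆ a, Q x a b' := fun x b' => exists_eq_ciSup_of_finite
    choose π hπ using hmax
    have hmin : ∀ x, ∃ b', ⨆ a, Q x a b' = ⨅ b', ⨆ a, Q x a b' := fun x =>
      exists_eq_ciInf_of_finite (f := fun b' => ⨆ a, Q x a b')
    choose ν hν using hmin
    refine le_antisymm ?_ (le_ciInf fun ν' => ?_)
    -- The roles are exchanged: the greedy ν of the first mover bounds from above, the user's best
    -- reply π from below.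
    · refine ciInf_le_of_le (Set.finite_range _).bddBelow ν (ciSup_le fun π' => ?_)
      refine G.policyQ_le _ (fun s a b => ?_) s a b
      rw [hQ s a b]
      exact G.sum_P_mul_mono (fun x => (le_ciSup (f := fun a => Q x a (ν x))
        (Set.finite_range _).bddAbove (π' x (ν x))).trans (hν x).le) s a b
    · refine le_ciSup_of_le (Set.finite_range _).bddAbove π ?_
      refine G.le_policyQ _ (fun s a b => ?_) s a b
      rw [hQ s a b]
      exact G.sum_P_mul_mono (fun x => (ciInf_le (f := fun b' => ⨆ a, Q x a b')
        (Set.finite_range _).bddBelow (ν' x)).trans (hπ x (ν' x)).ge) s a b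

end MarkovGame

/-! ### DAQ as a random-coordinate scheme -/

section Bootstrap

variable {S A : Type*} [Finite A] [Nonempty A] {N : ℕ} [Nonempty (Fin N)]

theorem abs_bootstrap_le (o : TurnOrder) {Q : Fin N → S → A → ℝ} {c : ℝ}
    (h : ∀ i s a, |Q i s a| ≤ c) (s : S) : |bootstrap o Q s| ≤ c := by
  cases o
  · exact abs_ciSup_le_of_finite fun a => abs_ciInf_le_of_finite fun i => h i s a
  · exact abs_ciInf_le_of_finite fun i => abs_ciSup_le_of_finite fun a => h i s a

theorem abs_bootstrap_sub_le (o : TurnOrder) {Q Q' : Fin N → S → A → ℝ} {c : ℝ}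
    (h : ∀ i s a, |Q i s a - Q' i s a| ≤ c) (s : S) :
    |bootstrap o Q s - bootstrap o Q' s| ≤ c := by
  cases o
  · exact abs_ciSup_sub_ciSup_le_of_finite fun a =>
      abs_ciInf_sub_ciInf_le_of_finite fun i => h i s a
  · exact abs_ciInf_sub_ciInf_le_of_finite fun i =>
      abs_ciSup_sub_ciSup_le_of_finite fun a => h i s a

end Bootstrap

namespace MDP

variable {S A : Type*} [Fintype S] {N : ℕ}

/-- The Bellman optimality operator of the dummy game, on vectors indexed by `(i, s, a)`. -/
def bellman (M : MDP S A) (b : Fin N → ℝ) (o : TurnOrder) (Q : Fin N × S × A → ℝ)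
    (j : Fin N × S × A) : ℝ :=
  ∑ s', M.P j.2.1 j.2.2 s' * (M.r j.2.1 j.2.2 s' + b j.1
    + M.γ * bootstrap o (fun i s a => Q (i, s, a)) s')

theorem abs_sum_P_mul_le (M : MDP S A) {f : S → ℝ} {c : ℝ} (h : ∀ x, |f x| ≤ c) (s : S) (a : A) :
    |∑ s', M.P s a s' * f s'| ≤ c :=
  (M.dummyGame (N := 1) 0).abs_sum_P_mul_le h s a 0

variable [Fintype A] [Nonempty A] [Nonempty (Fin N)]

theorem abs_target_le (M : MDP S A) {b : Fin N → ℝ} (o : TurnOrder) {R : ℝ}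
    (hr : ∀ s a s' i, |M.r s a s' + b i| ≤ R) (Q : Fin N × S × A → ℝ) (j : Fin N × S × A) (s' : S) :
    |M.r j.2.1 j.2.2 s' + b j.1 + M.γ * bootstrap o (fun i s a => Q (i, s, a)) s'|
      ≤ R + M.γ * ‖Q‖ := by
  refine (abs_add_le _ _).trans (add_le_add (hr _ _ _ _) ?_)
  rw [abs_mul, abs_of_nonneg M.γ_nonneg]
  exact mul_le_mul_of_nonneg_left
    (abs_bootstrap_le o (fun i s a => norm_le_pi_norm Q (i, s, a)) s') M.γ_nonneg

theorem abs_bellman_sub_le (M : MDP S A) (b : Fin N → ℝ) (o : TurnOrder)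
    (Q Q' : Fin N × S × A → ℝ) (j : Fin N × S × A) :
    |M.bellman b o Q j - M.bellman b o Q' j| ≤ M.γ * ‖Q - Q'‖ := by
  unfold bellman
  rw [← Finset.sum_sub_distrib]
  simp_rw [← mul_sub, add_sub_add_left_eq_sub, ← mul_sub]
  refine M.abs_sum_P_mul_le (fun x => ?_) _ _
  rw [abs_mul, abs_of_nonneg M.γ_nonneg]
  exact mul_le_mul_of_nonneg_left
    (abs_bootstrap_sub_le o (fun i s a => norm_le_pi_norm (Q - Q') (i, s, a)) x) M.γ_nonneg

/-- Banach's theorem supplies a solution of the optimality equation, and the verification theorem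
`optQ_eq_of_bellman` identifies it with the optimal Q-function. -/
theorem bellman_optQ (M : MDP S A) (b : Fin N → ℝ) (o : TurnOrder) :
    M.bellman b o (fun j => M.optQ b o j.1 j.2.1 j.2.2)
      = fun j => M.optQ b o j.1 j.2.1 j.2.2 := by
  have hc : ContractingWith M.γ.toNNReal (M.bellman b o) := by
    refine ⟨Real.toNNReal_lt_one.2 M.γ_lt_one, LipschitzWith.of_dist_le_mul fun Q Q' => ?_⟩
    rw [Real.coe_toNNReal _ M.γ_nonneg, dist_eq_norm Q,
      dist_pi_le_iff (mul_nonneg M.γ_nonneg (norm_nonneg _))]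
    exact fun j => M.abs_bellman_sub_le b o Q Q' j
  have hQ : M.bellman b o (hc.fixedPoint _) = hc.fixedPoint _ := hc.fixedPoint_isFixedPt
  set Q := hc.fixedPoint _
  have h := (M.dummyGame b).optQ_eq_of_bellman o (Q := fun s a i => Q (i, s, a))
    fun s a i => by
      conv_lhs => rw [← hQ]
      cases o <;> rfl
  have : (fun j : Fin N × S × A => M.optQ b o j.1 j.2.1 j.2.2) = Q := by
    funext j
    simp only [MDP.optQ, h]
  rw [this, hQ]

/-- Q-learning for the dummy game, where the sample `x` has the next state `next x` and updates
the entries `j` with `h x j = 1`. -/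
def scheme {X : Type*} [Fintype X] (M : MDP S A) (b : Fin N → ℝ) (o : TurnOrder)
    {α : ℝ} (hα₀ : 0 ≤ α) (hα₁ : α ≤ 1) {R : ℝ} (hR : 0 ≤ R)
    (hr : ∀ s a s' i, |M.r s a s' + b i| ≤ R)
    (law : X → ℝ) (hl : ∀ x, 0 ≤ law x) (hl_sum : ∑ x, law x = 1)
    (h : X → Fin N × S × A → ℝ) (hh : ∀ x j, h x j = 0 ∨ h x j = 1) (next : X → S)
    (D : Fin N × S × A → ℝ)
    (hD : ∀ j (f : S → ℝ), ∑ x, law x * (h x j * f (next x))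
      = D j * ∑ s', M.P j.2.1 j.2.2 s' * f s') :
    RandomCoordScheme (Fin N × S × A) X where
  law := law
  law_nonneg := hl
  law_sum := hl_sum
  h := h
  h_eq := hh
  T Q x j := M.r j.2.1 j.2.2 (next x) + b j.1
    + M.γ * bootstrap o (fun i s a => Q (i, s, a)) (next x)
  F := M.bellman b o
  D := D
  -- `hD` says that, given an update of j, the next state has law P. The constant 1 gives the update
  -- probability, and the target gives the mean F.
  sum_h j := by simpa [M.P_sum] using hD j 1
  sum_h_T Q j := hD j fun s' =>
    M.r j.2.1 j.2.2 s' + b j.1 + M.γ * bootstrap o (fun i s a => Q (i, s, a)) s'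
  γ := M.γ
  γ_nonneg := M.γ_nonneg
  γ_lt_one := M.γ_lt_one
  F_lip := M.abs_bellman_sub_le b o
  R := R
  R_nonneg := hR
  T_bound Q x j := M.abs_target_le o hr Q j (next x)
  F_bound Q j := M.abs_sum_P_mul_le (M.abs_target_le o hr Q j) _ _
  α := α
  α_nonneg := hα₀
  α_le_one := hα₁

end MDP

/-! ### Comparison with the stated constants and conclusion -/

theorem geometric_add_sqrt_le_daqBound {γ α dmax dmin R : ℝ} {m N : ℕ} (hγ₀ : 0 ≤ γ) (hγ₁ : γ < 1)
    (hα₀ : 0 < α) (hα₁ : α < 1) (hmin₀ : 0 < dmin) (hmin₁ : dmin ≤ 1) (hmm : dmin ≤ dmax)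
    (hR : 0 ≤ R) (hm : 1 ≤ m) (hN : 1 ≤ N) (t : ℕ) :
    2 * (R / (1 - γ)) * (1 - α * dmin * (1 - γ)) ^ t
        + dmax / (dmin * (1 - γ)) * (√(α * (m * N : ℕ)) * (2 * (R / (1 - γ))))
      ≤ R * daqBound γ α dmax dmin m N t := by
  have hg : 0 < 1 - γ := by linarith
  have hdmax : 0 < dmax := hmin₀.trans_le hmm
  have hρ : 0 ≤ 1 - α * dmin * (1 - γ) := sub_nonneg.2 (mul_le_one₀
    (mul_le_one₀ hα₁.le hmin₀.le hmin₁) hg.le (by linarith))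
  have hm' : (1 : ℝ) ≤ m := by exact_mod_cast hm
  have hN' : (1 : ℝ) ≤ N := by exact_mod_cast hN
  have h₁ : dmax / (dmin * (1 - γ)) * (√(α * (m * N : ℕ)) * (2 * (R / (1 - γ))))
      ≤ R * (27 * dmax * m * N * α ^ (1 / 2 : ℝ)
        / (dmin ^ (3 / 2 : ℝ) * (1 - γ) ^ (5 / 2 : ℝ))) := by
    -- The stated bound is weaker in each factor: √(mN) ≤ mN, and raising the exponents of d_min and
    -- 1 - γ, both in (0, 1], shrinks the denominator.
    have e1 : √(α * (m * N : ℕ)) ≤ α ^ (1 / 2 : ℝ) * (m * N) := by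
      rw [Real.sqrt_mul hα₀.le, Real.sqrt_eq_rpow α]
      refine mul_le_mul_of_nonneg_left ?_ (Real.rpow_nonneg hα₀.le _)
      push_cast
      have : (1 : ℝ) ≤ m * N := one_le_mul_of_one_le_of_one_le hm' hN'
      exact Real.sqrt_le_iff.2 ⟨by linarith, by nlinarith⟩
    have e2 : dmin ^ (3 / 2 : ℝ) ≤ dmin := by
      simpa using Real.rpow_le_rpow_of_exponent_ge hmin₀ hmin₁ (by norm_num : (1 : ℝ) ≤ 3 / 2)
    have e3 : (1 - γ) ^ (5 / 2 : ℝ) ≤ (1 - γ) ^ 2 := by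
      simpa using Real.rpow_le_rpow_of_exponent_ge hg (by linarith : 1 - γ ≤ 1)
        (by norm_num : (2 : ℝ) ≤ 5 / 2)
    have p2 : 0 < dmin ^ (3 / 2 : ℝ) := Real.rpow_pos_of_pos hmin₀ _
    have p3 : 0 < (1 - γ) ^ (5 / 2 : ℝ) := Real.rpow_pos_of_pos hg _
    calc dmax / (dmin * (1 - γ)) * (√(α * (m * N : ℕ)) * (2 * (R / (1 - γ))))
        ≤ dmax / (dmin * (1 - γ)) * ((α ^ (1 / 2 : ℝ) * (m * N)) * (2 * (R / (1 - γ)))) := by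
          gcongr
      _ = R * (2 * dmax * m * N * α ^ (1 / 2 : ℝ) / (dmin * (1 - γ) ^ 2)) := by
          field_simp
      _ ≤ _ := by
          have := Real.rpow_nonneg hα₀.le (1 / 2 : ℝ)
          gcongr
          norm_num
  have h₂ : 2 * (R / (1 - γ)) * (1 - α * dmin * (1 - γ)) ^ t
      ≤ R * (6 * (m : ℝ) ^ (3 / 2 : ℝ) * (N : ℝ) ^ (3 / 2 : ℝ) / (1 - γ)
        * (1 - α * dmin * (1 - γ)) ^ t) := by
    have e1 : 1 ≤ (m : ℝ) ^ (3 / 2 : ℝ) := Real.one_le_rpow hm' (by norm_num)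
    have e2 : 1 ≤ (N : ℝ) ^ (3 / 2 : ℝ) := Real.one_le_rpow hN' (by norm_num)
    have e3 : 1 ≤ (m : ℝ) ^ (3 / 2 : ℝ) * (N : ℝ) ^ (3 / 2 : ℝ) :=
      one_le_mul_of_one_le_of_one_le e1 e2
    calc 2 * (R / (1 - γ)) * (1 - α * dmin * (1 - γ)) ^ t
        = R * (2 / (1 - γ) * (1 - α * dmin * (1 - γ)) ^ t) := by ring
      _ ≤ _ := by
          gcongr
          linarith
  -- The third term is pure slack; only its sign matters.
  have h₃ : 0 ≤ R * (24 * γ * dmax * (m : ℝ) ^ (2 / 3 : ℝ) * (N : ℝ) ^ (2 / 3 : ℝ) / (1 - γ)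
        * (3 / (dmin * (1 - γ))) * (1 - α * dmin * (1 - γ)) ^ ((t : ℝ) / 2 - 1)) := by
    have := Real.rpow_nonneg hρ ((t : ℝ) / 2 - 1)
    positivity
  unfold daqBound
  simp only [mul_add]
  linarith

/-- The error bound for any coordinate-wise sampling scheme of Q-learning for the dummy game. -/
theorem MDP.integral_norm_sub_optQ_le {S A : Type*} [Fintype S] [Nonempty S] [Fintype A]
    [Nonempty A] {N : ℕ} {Ω X : Type*} [MeasurableSpace Ω] {Pr : Measure Ω}
    [IsProbabilityMeasure Pr] [Fintype X] [MeasurableSpace X] [DiscreteMeasurableSpace X]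
    (M : MDP S A) (hN : 1 ≤ N) (b : Fin N → ℝ) (o : TurnOrder)
    {α : ℝ} (hα₀ : 0 < α) (hα₁ : α < 1) {R : ℝ} (hR : 1 ≤ R)
    (hr : ∀ s a s' i, |M.r s a s' + b i| ≤ R)
    {Q₀ : Fin N → S → A → ℝ} (hQ₀ : ∀ i s a, |Q₀ i s a| ≤ 1)
    {law : X → ℝ} (hl : ∀ x, 0 ≤ law x) (hl_sum : ∑ x, law x = 1)
    {h : X → Fin N × S × A → ℝ} (hh : ∀ x j, h x j = 0 ∨ h x j = 1) {next : X → S}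
    {D : Fin N × S × A → ℝ}
    (hD : ∀ j (f : S → ℝ), ∑ x, law x * (h x j * f (next x))
      = D j * ∑ s', M.P j.2.1 j.2.2 s' * f s')
    {dmax dmin : ℝ} (hmax : ∀ j, D j ≤ dmax) (hmin : ∀ j, dmin ≤ D j) (hmin₀ : 0 < dmin)
    {Q : (ℕ → X) → ℕ → Fin N → S → A → ℝ} (hQ_zero : ∀ z, Q z 0 = Q₀)
    (hQ_succ : ∀ z t i s a, Q z (t + 1) i s a = Q z t i s a + α * (h (z t) (i, s, a)
      * (M.r s a (next (z t)) + b i + M.γ * bootstrap o (Q z t) (next (z t)) - Q z t i s a)))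
    {Z : ℕ → Ω → X} (hZ : IsIIDSample Pr law Z) (i : Fin N) (t : ℕ) :
    Integrable (fun ω => ‖Q (fun k => Z k ω) t i - M.optQ b o i‖) Pr ∧
      ∫ ω, ‖Q (fun k => Z k ω) t i - M.optQ b o i‖ ∂Pr
        ≤ R * daqBound M.γ α dmax dmin (Fintype.card (S × A)) N t := by
  have : Nonempty (Fin N) := ⟨i⟩
  set C := M.scheme b o hα₀.le hα₁.le (zero_le_one.trans hR) hr law hl hl_sum h hh next D hD
  set q₀ : Fin N × S × A → ℝ := fun j => Q₀ j.1 j.2.1 j.2.2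
  have hiter : ∀ z t, C.iter q₀ z t = fun j => Q z t j.1 j.2.1 j.2.2 := by
    intro z t
    induction t with
    | zero => rw [hQ_zero]; rfl
    | succ t ih =>
      funext j
      rw [hQ_succ]
      simp only [RandomCoordScheme.iter, ih]
      rfl
  set Qs : Fin N × S × A → ℝ := fun j => M.optQ b o j.1 j.2.1 j.2.2
  have hg : 0 < 1 - M.γ := by linarith [M.γ_lt_one]
  -- Since R ≥ 1, initial values bounded by 1 lie in the invariant ball.
  have h₀ : ‖q₀‖ ≤ C.R / (1 - C.γ) := by
    refine ((pi_norm_le_iff_of_nonneg zero_le_one).2 fun j => hQ₀ _ _ _).trans ?_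
    change 1 ≤ R / (1 - M.γ)
    rw [one_le_div hg]
    linarith [M.γ_nonneg]
  have hs : C.F Qs = Qs := M.bellman_optQ b o
  have hmain := C.integral_norm_iter_sub_le hZ hs h₀ hmax hmin hmin₀ t
  have hle : ∀ ω, ‖Q (fun k => Z k ω) t i - M.optQ b o i‖
      ≤ ‖C.iter q₀ (fun k => Z k ω) t - Qs‖ := fun ω => by
    refine (pi_norm_le_iff_of_nonneg (norm_nonneg _)).2 fun s =>
      (pi_norm_le_iff_of_nonneg (norm_nonneg _)).2 fun a => ?_
    rw [hiter]
    exact norm_le_pi_norm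
      ((fun j : Fin N × S × A => Q (fun k => Z k ω) t j.1 j.2.1 j.2.2) - Qs) (i, s, a)
  have hint : Integrable (fun ω => ‖Q (fun k => Z k ω) t i - M.optQ b o i‖) Pr :=
    DependsOnPast.integrable (f := fun z => ‖Q z t i - M.optQ b o i‖) hZ.measurable
      fun z z' hz => by
        have h1 := C.dependsOnPast_iter q₀ t z z' hz
        simp only [hiter] at h1
        have h2 : Q z t i = Q z' t i := by
          funext s a
          exact congrFun h1 (i, s, a)
        simp only [h2]
  refine ⟨hint, (integral_mono hint (C.integrable_norm_iter_sub hZ q₀ Qs t) hle).trans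
    (hmain.trans ?_)⟩
  have hcard : Fintype.card (Fin N × S × A) = Fintype.card (S × A) * N := by
    rw [Fintype.card_prod (Fin N), Fintype.card_fin, mul_comm]
  rw [hcard]
  obtain ⟨s⟩ := ‹Nonempty S›
  obtain ⟨a⟩ := ‹Nonempty A›
  exact geometric_add_sqrt_le_daqBound M.γ_nonneg M.γ_lt_one hα₀ hα₁ hmin₀
    ((hmin (i, s, a)).trans (C.D_le_one _)) ((hmin (i, s, a)).trans (hmax _))
    (zero_le_one.trans hR) (Fintype.card_pos_iff.2 ⟨(s, a)⟩) hN t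

end

theorem theorem1 {S A : Type*} [Fintype S] [Nonempty S] [Fintype A] [Nonempty A]
    [MeasurableSpace S] [DiscreteMeasurableSpace S]
    [MeasurableSpace A] [DiscreteMeasurableSpace A]
    {Ω : Type*} [MeasurableSpace Ω] (Pr : Measure Ω) [IsProbabilityMeasure Pr]
    (M : MDP S A) (N : ℕ) (hN : 1 ≤ N) (b : Fin N → ℝ)
    (α : ℝ) (hα₀ : 0 < α) (hα₁ : α < 1)
    (R : ℝ) (hR : 1 ≤ R) (hr : ∀ s a s' i, |M.r s a s' + b i| ≤ R)
    (Q₀ : Fin N → S → A → ℝ) (hQ₀ : ∀ i s a, |Q₀ i s a| ≤ 1)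
    (d : S → A → ℝ) (hd : ∀ s a, 0 < d s a) (hd_sum : ∑ s, ∑ a, d s a = 1)
    (o : TurnOrder) :
    (∀ (μ : Fin N → ℝ), (∀ i, 0 < μ i) → ∑ i, μ i = 1 →
      ∀ (Z : ℕ → Ω → S × A × Fin N × S),
        IsIIDSample Pr (fun x : S × A × Fin N × S =>
          d x.1 x.2.1 * μ x.2.2.1 * M.P x.1 x.2.1 x.2.2.2) Z →
        ∀ (i : Fin N) (t : ℕ),
          Integrable (fun ω => ‖daqAsync M b o α Q₀ (fun k => Z k ω) t i - M.optQ b o i‖) Pr ∧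
          ∫ ω, ‖daqAsync M b o α Q₀ (fun k => Z k ω) t i - M.optQ b o i‖ ∂Pr ≤
            R * daqBound M.γ α (⨆ x : S × A × Fin N, d x.1 x.2.1 * μ x.2.2)
              (⨅ x : S × A × Fin N, d x.1 x.2.1 * μ x.2.2) (Fintype.card (S × A)) N t) ∧
    (∀ (Z : ℕ → Ω → S × A × S),
        IsIIDSample Pr (fun x : S × A × S => d x.1 x.2.1 * M.P x.1 x.2.1 x.2.2) Z →
        ∀ (i : Fin N) (t : ℕ),
          Integrable (fun ω => ‖daqSync M b o α Q₀ (fun k => Z k ω) t i - M.optQ b o i‖) Pr ∧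
          ∫ ω, ‖daqSync M b o α Q₀ (fun k => Z k ω) t i - M.optQ b o i‖ ∂Pr ≤
            R * daqBound M.γ α (⨆ x : S × A, d x.1 x.2) (⨅ x : S × A, d x.1 x.2)
              (Fintype.card (S × A)) N t) := by
  classical
  have : Nonempty (Fin N) := ⟨⟨0, hN⟩⟩
  refine ⟨fun μ hμ hμ_sum Z hZ i t => ?_, fun Z hZ i t => ?_⟩
  · refine M.integral_norm_sub_optQ_le hN b o hα₀ hα₁ hR hr hQ₀
      (h := fun x j => if j.1 = x.2.2.1 ∧ j.2.1 = x.1 ∧ j.2.2 = x.2.1 then 1 else 0)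
      (next := fun x => x.2.2.2) (D := fun j => d j.2.1 j.2.2 * μ j.1)
      (Q := fun z t => daqAsync M b o α Q₀ z t)
      (fun x => mul_nonneg (mul_pos (hd _ _) (hμ _)).le (M.P_nonneg _ _ _)) ?_ ?_ ?_ ?_ ?_ ?_
      (fun z => rfl) ?_ hZ i t
    · simp only [Fintype.sum_prod_type, ← Finset.mul_sum, M.P_sum, mul_one, hμ_sum, hd_sum]
    · intro x j
      split_ifs <;> simp
    · rintro ⟨i, s, a⟩ f
      simp only [Fintype.sum_prod_type]
      rw [Finset.sum_eq_single s, Finset.sum_eq_single a, Finset.sum_eq_single i, Finset.mul_sum]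
      · exact Finset.sum_congr rfl fun s' _ => by simp; ring
      all_goals simp +contextual [eq_comm]
    · exact fun j => le_ciSup (f := fun x : S × A × Fin N => d x.1 x.2.1 * μ x.2.2)
        (Set.finite_range _).bddAbove (j.2.1, j.2.2, j.1)
    · exact fun j => ciInf_le (f := fun x : S × A × Fin N => d x.1 x.2.1 * μ x.2.2)
        (Set.finite_range _).bddBelow (j.2.1, j.2.2, j.1)
    · obtain ⟨x, hx⟩ := exists_eq_ciInf_of_finite
        (f := fun x : S × A × Fin N => d x.1 x.2.1 * μ x.2.2)
      exact hx ▸ mul_pos (hd _ _) (hμ _)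
    · intro z t i s a
      simp only [daqAsync, daqAsyncStep, daqEntry]
      split_ifs with h
      · obtain ⟨rfl, rfl, rfl⟩ := h
        ring
      · ring
  · refine M.integral_norm_sub_optQ_le hN b o hα₀ hα₁ hR hr hQ₀
      -- The indicator ignores the estimator index, so one sample drives all N estimators. Their
      -- noises are dependent, which is harmless for coordinatewise second moments.
      (h := fun x j => if j.2.1 = x.1 ∧ j.2.2 = x.2.1 then 1 else 0)
      (next := fun x => x.2.2) (D := fun j => d j.2.1 j.2.2)
      (Q := fun z t => daqSync M b o α Q₀ z t)
      (fun x => mul_nonneg (hd _ _).le (M.P_nonneg _ _ _)) ?_ ?_ ?_ ?_ ?_ ?_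
      (fun z => rfl) ?_ hZ i t
    · simp only [Fintype.sum_prod_type, ← Finset.mul_sum, M.P_sum, mul_one, hd_sum]
    · intro x j
      split_ifs <;> simp
    · rintro ⟨i, s, a⟩ f
      simp only [Fintype.sum_prod_type]
      rw [Finset.sum_eq_single s, Finset.sum_eq_single a, Finset.mul_sum]
      · exact Finset.sum_congr rfl fun s' _ => by simp; ring
      all_goals simp +contextual [eq_comm]
    · exact fun j => le_ciSup (f := fun x : S × A => d x.1 x.2)
        (Set.finite_range _).bddAbove j.2
    · exact fun j => ciInf_le (f := fun x : S × A => d x.1 x.2)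
        (Set.finite_range _).bddBelow j.2
    · obtain ⟨x, hx⟩ := exists_eq_ciInf_of_finite (f := fun x : S × A => d x.1 x.2)
      exact hx ▸ hd _ _
    · intro z t i s a
      simp only [daqSync, daqSyncStep, daqEntry]
      split_ifs with h
      · obtain ⟨rfl, rfl⟩ := h
        ring
      · ring
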